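/- All graphs are finite, undirected and simple. A path decomposition of a graph $F$ is a collection of pairwise edge-disjoint paths of $F$ that together cover all the edges of $F$; let $p(F)$ denote the minimum number of paths in a path decomposition of $F$. The Cartesian product $G\Box H$ is the graph with vertex set $V(G)\times V(H)$ in which $(u_1,v_1)$ and $(u_2,v_2)$ are adjacent if and only if either $u_1u_2\in E(G)$ and $v_1=v_2$, or $v_1v_2\in E(H)$ and $u_1=u_2$. Let $G$ be a connected graph of order $m\ge 2$ in which every vertex has odd degree, and let $H$ be a connected graph of order $n$. Then $p(G\Box H)\le \frac{mn}{2}$. -/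

import Mathlib

namespace SimpleGraph

/-- A subgraph of `G` is a path if it is the subgraph traced by some walk without repeated
vertices. -/
def Subgraph.IsPathSubgraph {V : Type*} {G : SimpleGraph V} (P : G.Subgraph) : Prop :=
  ∃ (u v : V) (w : G.Walk u v), w.IsPath ∧ P = w.toSubgraph

/-- A path decomposition of `G`: a finite collection of paths of `G` that are pairwise
edge-disjoint and together cover all the edges of `G`. -/
structure IsPathDecomposition {V : Type*} (G : SimpleGraph V) (D : Finset G.Subgraph) : Prop where
  isPath : ∀ P ∈ D, P.IsPathSubgraph
  edgeDisjoint : ∀ P ∈ D, ∀ Q ∈ D, P ≠ Q → Disjoint P.edgeSet Q.edgeSet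
  covers : ∀ e ∈ G.edgeSet, ∃ P ∈ D, e ∈ P.edgeSet

/-- `p(G)`: the minimum number of paths in a path decomposition of `G`. For a finite graph the
minimum is over a nonempty set, by `exists_isPathDecomposition` below. -/
noncomputable def pathNumber {V : Type*} (G : SimpleGraph V) : ℕ :=
  sInf {k : ℕ | ∃ D : Finset G.Subgraph, G.IsPathDecomposition D ∧ D.card = k}

/-- Every finite graph has a path decomposition (take its single edges). -/
theorem exists_isPathDecomposition {V : Type*} [Finite V] (G : SimpleGraph V) :
    ∃ D : Finset G.Subgraph, G.IsPathDecomposition D := by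
  classical
  have hfin : {P : G.Subgraph | ∃ (u v : V) (h : G.Adj u v), P = G.subgraphOfAdj h}.Finite :=
    Set.toFinite _
  refine ⟨hfin.toFinset, ?_, ?_, ?_⟩
  · intro P hP
    obtain ⟨u, v, h, rfl⟩ := hfin.mem_toFinset.1 hP
    refine ⟨u, v, h.toWalk, ?_, ?_⟩
    · simp [h.ne]
    · simp
  · intro P hP Q hQ hne
    obtain ⟨u, v, h, rfl⟩ := hfin.mem_toFinset.1 hP
    obtain ⟨x, y, h', rfl⟩ := hfin.mem_toFinset.1 hQ
    rw [Set.disjoint_left]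
    intro e he he'
    simp only [edgeSet_subgraphOfAdj, Set.mem_singleton_iff] at he he'
    apply hne
    rw [he, Sym2.eq_iff] at he'
    rcases he' with ⟨rfl, rfl⟩ | ⟨rfl, rfl⟩
    · rfl
    · exact (subgraphOfAdj_symm h').symm ▸ rfl
  · intro e
    induction e using Sym2.ind with
    | _ u v =>
      intro he
      have h : G.Adj u v := (mem_edgeSet G).1 he
      exact ⟨G.subgraphOfAdj h, hfin.mem_toFinset.2 ⟨u, v, h, rfl⟩, by simp⟩

end SimpleGraph

/-! ### Paths as duplicate-free vertex lists -/

section PathLists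

variable {V : Type*}

/-! By Lovász, every graph decomposes into paths, trivial ones allowed, with each odd vertex one
path end and each even vertex two (`exists_isPathFamily`). In G all degrees are odd, so there are
m/2 nontrivial paths whose ends enumerate V exactly once. In H every path has two ends and every
vertex is at most two ends, so by Hall's theorem the paths can start at distinct vertices; with
trivial paths at the unused vertices, there is one path r_v from each v (`exists_rooted_paths`). For
each path p of G and each v, the copies of r_v over the two ends of p are linked by the copy of p at
v (`exists_product_path`). These (m/2)n paths use each copy of an edge of G once, and each copy of
an edge of H once because each u is an end of exactly one p.

Lovász's theorem goes by induction on the edge set, strengthened to let one even vertex be no end.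
Its engine is `exists_insert_edge`. If a path avoiding a ends at x, the missing edge ax prolongs it.
If instead a path ends with a, y, ..., x, that stretch becomes a, x, ..., y, and ay is now the
missing edge. No stretch is reversed twice, so the process stops. -/

/-- The edges traversed by a list of vertices. -/
def pathEdges : List V → Multiset (Sym2 V)
  | [] => 0
  | [_] => 0
  | a :: b :: l => s(a, b) ::ₘ pathEdges (b :: l)

/-- The first and the last vertex of a list of vertices; a one-vertex list counts it twice. -/
def pathEnds (l : List V) : Multiset V :=
  (l.head?.toList ++ l.getLast?.toList : List V)

@[simp] lemma pathEdges_nil : pathEdges ([] : List V) = 0 := rfl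

@[simp] lemma pathEdges_singleton (a : V) : pathEdges [a] = 0 := rfl

@[simp] lemma pathEdges_cons_cons (a b : V) (l : List V) :
    pathEdges (a :: b :: l) = s(a, b) ::ₘ pathEdges (b :: l) := rfl

lemma pathEdges_append_cons (l : List V) (a : V) (r : List V) :
    pathEdges (l ++ a :: r) = pathEdges (l ++ [a]) + pathEdges (a :: r) := by
  induction l with
  | nil => simp
  | cons b l ih =>
    cases l with
    | nil => simp
    | cons c l => simpa using ih

lemma pathEdges_reverse (l : List V) : pathEdges l.reverse = pathEdges l := by
  induction l with
  | nil => rfl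
  | cons a l ih =>
    cases l with
    | nil => rfl
    | cons b l =>
      rw [List.reverse_cons, List.reverse_cons, List.append_assoc, List.singleton_append,
        pathEdges_append_cons, ← List.reverse_cons, ih, pathEdges_cons_cons, pathEdges_cons_cons,
        pathEdges_singleton, Sym2.eq_swap, ← Multiset.singleton_add, ← Multiset.singleton_add,
        add_zero, add_comm]

lemma pathEdges_reverse_append_cons (l : List V) (a : V) (r : List V) :
    pathEdges (l.reverse ++ a :: r) = pathEdges (a :: l) + pathEdges (a :: r) := by
  rw [pathEdges_append_cons, ← List.reverse_cons, pathEdges_reverse]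

lemma pathEdges_cons_of_head? {a y : V} {l : List V} (h : l.head? = some y) :
    pathEdges (a :: l) = s(a, y) ::ₘ pathEdges l := by
  cases l with
  | nil => simp at h
  | cons b l => simp at h; subst h; rfl

lemma pathEdges_map {W : Type*} (f : V → W) (l : List V) :
    pathEdges (l.map f) = (pathEdges l).map (Sym2.map f) := by
  induction l with
  | nil => rfl
  | cons a l ih =>
    cases l with
    | nil => rfl
    | cons b l => simpa using ih

lemma not_isDiag_of_mem_pathEdges {l : List V} (hl : l.Nodup) {e : Sym2 V}
    (he : e ∈ pathEdges l) : ¬ e.IsDiag := by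
  induction l with
  | nil => simp at he
  | cons a l ih =>
    cases l with
    | nil => simp at he
    | cons b l =>
      rw [pathEdges_cons_cons, Multiset.mem_cons] at he
      rcases he with rfl | he
      · rintro (h : a = b)
        simp [h] at hl
      · exact ih hl.of_cons he

lemma pathEnds_reverse (l : List V) : pathEnds l.reverse = pathEnds l := by
  simp only [pathEnds, List.head?_reverse, List.getLast?_reverse, ← Multiset.coe_add, add_comm]

lemma eq_singleton_or_exists_mem_pathEdges {p : List V} {c : V} (hc : c ∈ pathEnds p) :
    p = [c] ∨ ∃ e ∈ pathEdges p, c ∈ e := by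
  suffices H : ∀ q : List V, q.head? = some c → q = [c] ∨ ∃ e ∈ pathEdges q, c ∈ e by
    simp only [pathEnds, Multiset.mem_coe, List.mem_append, Option.mem_toList] at hc
    rcases hc with hc | hc
    · exact H p hc
    · have := H p.reverse (by simpa using hc)
      rw [pathEdges_reverse] at this
      simpa using this
  rintro (_ | ⟨b, _ | ⟨d, q⟩⟩) h
  · simp at h
  · simp at h; simp [h]
  · simp at h
    exact Or.inr ⟨s(b, d), by simp, by simp [h]⟩

/-! ### Arms at a vertex and the insertion of an edge -/

/-- Two lists that can be attached to `a` by their heads so as to form a path through `a`. -/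
def ArmPair (a : V) (l r : List V) : Prop :=
  a ∉ l ∧ a ∉ r ∧ l.Nodup ∧ r.Nodup ∧ l.Disjoint r

/-- The flagged lists occurring in a multiset of pairs. -/
def arms (T : Multiset ((List V × Bool) × (List V × Bool))) : Multiset (List V × Bool) :=
  T.map Prod.fst + T.map Prod.snd

@[simp] lemma arms_cons (t : (List V × Bool) × (List V × Bool))
    (T : Multiset ((List V × Bool) × (List V × Bool))) :
    arms (t ::ₘ T) = t.1 ::ₘ t.2 ::ₘ arms T := by
  simp [arms, Multiset.cons_swap]

lemma ArmPair.symm {a : V} {l r : List V} (h : ArmPair a l r) : ArmPair a r l :=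
  ⟨h.2.1, h.1, h.2.2.2.1, h.2.2.1, h.2.2.2.2.symm⟩

lemma exists_arms_eq_cons {a : V} {T : Multiset ((List V × Bool) × (List V × Bool))}
    (hT : ∀ t ∈ T, ArmPair a t.1.1 t.2.1) {A : List V × Bool} (hA : A ∈ arms T) :
    ∃ B T', arms T = A ::ₘ B ::ₘ arms T' ∧ ArmPair a A.1 B.1 ∧
      ∀ t ∈ T', ArmPair a t.1.1 t.2.1 := by
  rw [arms, Multiset.mem_add, Multiset.mem_map, Multiset.mem_map] at hA
  rcases hA with ⟨t, ht, rfl⟩ | ⟨t, ht, rfl⟩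
  · obtain ⟨T', rfl⟩ := Multiset.exists_cons_of_mem ht
    exact ⟨t.2, T', by simp, hT t ht, fun s hs => hT s (Multiset.mem_cons_of_mem hs)⟩
  · obtain ⟨T', rfl⟩ := Multiset.exists_cons_of_mem ht
    exact ⟨t.1, T', by simp [Multiset.cons_swap], (hT t ht).symm,
      fun s hs => hT s (Multiset.mem_cons_of_mem hs)⟩

/-- The paths through `a` formed by pairs of arms have the expected edges and ends. -/
lemma exists_paths_of_armPairs {a : V} (T : Multiset ((List V × Bool) × (List V × Bool)))
    (hT : ∀ t ∈ T, ArmPair a t.1.1 t.2.1) :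
    ∃ M : Multiset (List V), (∀ p ∈ M, p ≠ [] ∧ p.Nodup) ∧
      M.bind pathEdges = (arms T).bind (fun A => pathEdges (a :: A.1)) ∧
      M.bind pathEnds = (arms T).map (fun A => A.1.getLast?.getD a) := by
  induction T using Multiset.induction with
  | empty => exact ⟨0, by simp [arms]⟩
  | cons t T ih =>
    obtain ⟨M, h1, h2, h3⟩ := ih fun s hs => hT s (Multiset.mem_cons_of_mem hs)
    obtain ⟨h4, h5, h6, h7, h8⟩ := hT t (Multiset.mem_cons_self _ _)
    refine ⟨(t.1.1.reverse ++ a :: t.2.1) ::ₘ M, ?_, ?_, ?_⟩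
    · intro p hp
      rcases Multiset.mem_cons.1 hp with rfl | hp
      · refine ⟨by simp, ?_⟩
        rw [List.nodup_append']
        refine ⟨List.nodup_reverse.2 h6, List.nodup_cons.2 ⟨h5, h7⟩, ?_⟩
        rw [List.disjoint_cons_right]
        exact ⟨by simpa using h4, fun x hx hy => h8 (List.mem_reverse.1 hx) hy⟩
      · exact h1 p hp
    · simp [h2, pathEdges_reverse_append_cons, add_assoc]
    · rw [Multiset.cons_bind, h3]
      have : pathEnds (t.1.1.reverse ++ a :: t.2.1) =
          t.1.1.getLast?.getD a ::ₘ t.2.1.getLast?.getD a ::ₘ 0 := by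
        rw [pathEnds, List.head?_append, List.getLast?_append, List.getLast?_cons,
          List.head?_reverse]
        cases t.1.1.getLast? <;> rfl
      simp [this]

/-- Reversing arms, one after the other, makes room for a missing edge at `a`. The flag of an arm
records that it has not been reversed. -/
lemma exists_insert_edge_of_arms (a : V) (F : Multiset (Sym2 V)) (hF : F.Nodup) (k : ℕ) :
    ∀ (T : Multiset ((List V × Bool) × (List V × Bool))) (O : Multiset (List V)) (x : V),
      ((arms T).filter (fun A => A.2 = true)).card = k →
      (∀ t ∈ T, ArmPair a t.1.1 t.2.1) → (∀ p ∈ O, p ≠ [] ∧ p.Nodup ∧ a ∉ p) →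
      s(a, x) ::ₘ ((arms T).bind (fun A => pathEdges (a :: A.1)) + O.bind pathEdges) = F →
      (∀ v, s(a, v) ∈ F → (∃ A ∈ arms T, A.2 = true ∧ A.1.getLast? = some v) ∨
        (∃ p ∈ O, v ∈ pathEnds p) ∨ (∃ A ∈ arms T, A.2 = false ∧ A.1.head? = some v)) →
      ∃ M : Multiset (List V), (∀ p ∈ M, p ≠ [] ∧ p.Nodup) ∧ M.bind pathEdges = F ∧
        M.bind pathEnds + {x} =
          (arms T).map (fun A => A.1.getLast?.getD a) + O.bind pathEnds + {a} := by
  induction k with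
  | zero => ?_
  | succ k ih => ?_
  all_goals
    intro T O x hk hT hO hE hv
    -- The end x lies on an unreversed arm, on a path avoiding `a`, or next to `a` on a reversed
    -- arm. Only the first case recurses.
    rcases hv x (by simp [← hE]) with ⟨A, hA, hA1, hA2⟩ | ⟨p, hp, hx⟩ | ⟨A, hA, -, hA2⟩
    rotate_left
    · obtain ⟨O, rfl⟩ := Multiset.exists_cons_of_mem hp
      obtain ⟨hp0, hp1, hp2⟩ := hO p hp
      obtain ⟨q, hq0, hq1, hq2, hq3, hq4⟩ : ∃ q : List V, q.head? = some x ∧ q.Nodup ∧ a ∉ q ∧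
          pathEdges q = pathEdges p ∧ pathEnds q = pathEnds p := by
        simp only [pathEnds, Multiset.mem_coe, List.mem_append, Option.mem_toList] at hx
        rcases hx with hx | hx
        · exact ⟨p, hx, hp1, hp2, rfl, rfl⟩
        · exact ⟨p.reverse, by simpa using hx, by simpa using hp1, by simpa using hp2,
            pathEdges_reverse p, pathEnds_reverse p⟩
      obtain ⟨M, h1, h2, h3⟩ := exists_paths_of_armPairs T hT
      refine ⟨(a :: q) ::ₘ (M + O), ?_, ?_, ?_⟩
      · intro r hr
        rw [Multiset.mem_cons, Multiset.mem_add] at hr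
        rcases hr with rfl | hr | hr
        · exact ⟨by simp, List.nodup_cons.2 ⟨hq2, hq1⟩⟩
        · exact h1 r hr
        · exact ⟨(hO r (Multiset.mem_cons_of_mem hr)).1, (hO r (Multiset.mem_cons_of_mem hr)).2.1⟩
      · rw [← hE, Multiset.cons_bind, Multiset.add_bind, Multiset.cons_bind, h2,
          pathEdges_cons_of_head? hq0, hq3, Multiset.cons_add]
        congr 1
        abel
      · have : pathEnds (a :: q) + {x} = pathEnds p + {a} := by
          rw [← hq4]
          cases q with
          | nil => simp at hq0
          | cons b q =>
            simp only [List.head?_cons, Option.some.injEq] at hq0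
            subst hq0
            simp only [pathEnds, List.getLast?_cons, List.head?_cons, Option.toList,
              List.singleton_append]
            simp only [← Multiset.cons_coe, Multiset.coe_nil, Option.getD_some,
              ← Multiset.singleton_add]
            abel
        rw [Multiset.cons_bind, Multiset.add_bind, Multiset.cons_bind, h3,
          add_right_comm, this]
        abel
    -- A reversed arm beginning with x already uses ax, which would then occur twice in `F`.
    · exfalso
      rw [← hE, Multiset.nodup_cons] at hF
      refine hF.1 (Multiset.mem_add.2 (Or.inl (Multiset.mem_bind.2 ⟨A, hA, ?_⟩)))
      rw [pathEdges_cons_of_head? hA2]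
      exact Multiset.mem_cons_self _ _
  · exfalso
    rw [Multiset.card_eq_zero, Multiset.filter_eq_nil] at hk
    exact hk A hA hA1
  -- Reversing the arm makes it use ax and frees ay. Its vertex set is unchanged, so its pair still
  -- forms a path, and one fewer arm is unreversed.
  · obtain ⟨l, b⟩ := A
    obtain rfl : b = true := hA1
    obtain ⟨B, T', hTT', hAB, hT'⟩ := exists_arms_eq_cons hT hA
    obtain ⟨y, hy⟩ : ∃ y, l.head? = some y := by
      cases l with
      | nil => simp at hA2
      | cons y l => exact ⟨y, rfl⟩
    simp only at hA2 hAB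
    have hrx : l.reverse.head? = some x := by simpa using hA2
    have hry : l.reverse.getLast? = some y := by simpa using hy
    have g1 : ((arms (((l.reverse, false), B) ::ₘ T')).filter (fun A => A.2 = true)).card = k := by
      rw [hTT'] at hk
      simp [Multiset.filter_cons] at hk ⊢
      omega
    have g2 : ∀ t ∈ ((l.reverse, false), B) ::ₘ T', ArmPair a t.1.1 t.2.1 := by
      intro t ht
      rcases Multiset.mem_cons.1 ht with rfl | ht
      · obtain ⟨g1, g2, g3, g4, g5⟩ := hAB
        exact ⟨by simpa using g1, g2, by simpa using g3, g4,
          fun z hz hz' => g5 (List.mem_reverse.1 hz) hz'⟩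
      · exact hT' t ht
    have g3 : s(a, y) ::ₘ ((arms (((l.reverse, false), B) ::ₘ T')).bind
        (fun A => pathEdges (a :: A.1)) + O.bind pathEdges) = F := by
      rw [← hE, hTT', arms_cons]
      simp only [Multiset.cons_bind]
      rw [pathEdges_cons_of_head? hrx, pathEdges_cons_of_head? hy, pathEdges_reverse]
      simp only [← Multiset.singleton_add]
      abel
    obtain ⟨M, h1, h2, h3⟩ := ih _ O y g1 g2 hO g3 <| by
      intro v hvF
      rw [arms_cons]
      rcases hv v hvF with ⟨C, hC, hC1, hC2⟩ | hO' | ⟨C, hC, hC1, hC2⟩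
      · rw [hTT', Multiset.mem_cons] at hC
        rcases hC with rfl | hC
        -- The old end of the arm is now its head, so the invariant survives in its third form.
        · refine Or.inr (Or.inr ⟨(l.reverse, false), Multiset.mem_cons_self _ _, rfl, ?_⟩)
          rw [← hC2]
          simp
        · exact Or.inl ⟨C, Multiset.mem_cons_of_mem hC, hC1, hC2⟩
      · exact Or.inr (Or.inl hO')
      · rw [hTT', Multiset.mem_cons] at hC
        rcases hC with rfl | hC
        · simp at hC1
        · exact Or.inr (Or.inr ⟨C, Multiset.mem_cons_of_mem hC, hC1, hC2⟩)
    refine ⟨M, h1, h2, ?_⟩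
    rw [arms_cons, Multiset.map_cons, Multiset.map_cons, hry, Option.getD_some] at h3
    rw [hTT', Multiset.map_cons, Multiset.map_cons, hA2, Option.getD_some]
    -- The intermediate end y, gained by the reversal and lost by the recursive call, cancels.
    apply add_right_cancel (b := ({y} : Multiset V))
    rw [add_right_comm, h3]
    simp only [← Multiset.singleton_add]
    abel

/-- Any multiset of paths can be cut at `a` into pairs of arms and paths avoiding `a`. -/
lemma exists_arms_of_paths (a : V) (M : Multiset (List V)) (hM : ∀ p ∈ M, p ≠ [] ∧ p.Nodup) :
    ∃ (T : Multiset ((List V × Bool) × (List V × Bool))) (O : Multiset (List V)),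
      (∀ t ∈ T, ArmPair a t.1.1 t.2.1) ∧ (∀ p ∈ O, p ≠ [] ∧ p.Nodup ∧ a ∉ p) ∧
      (∀ A ∈ arms T, A.2 = true) ∧
      (arms T).bind (fun A => pathEdges (a :: A.1)) + O.bind pathEdges = M.bind pathEdges ∧
      (arms T).map (fun A => A.1.getLast?.getD a) + O.bind pathEnds = M.bind pathEnds := by
  induction M using Multiset.induction with
  | empty => exact ⟨0, 0, by simp [arms]⟩
  | cons p M ih =>
    obtain ⟨T, O, h1, h2, h3, h4, h5⟩ := ih fun s hs => hM s (Multiset.mem_cons_of_mem hs)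
    obtain ⟨hp0, hp1⟩ := hM p (Multiset.mem_cons_self _ _)
    by_cases hap : a ∈ p
    · obtain ⟨s, r, rfl⟩ := List.append_of_mem hap
      rw [List.nodup_append', List.nodup_cons, List.disjoint_cons_right] at hp1
      obtain ⟨hs, ⟨har, hr⟩, has, hsr⟩ := hp1
      refine ⟨((s.reverse, true), (r, true)) ::ₘ T, O, ?_, h2, ?_, ?_, ?_⟩
      · intro t ht
        rcases Multiset.mem_cons.1 ht with rfl | ht
        · exact ⟨by simpa using has, har, by simpa using hs, hr,
            fun z hz hz' => hsr (List.mem_reverse.1 hz) hz'⟩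
        · exact h1 t ht
      · intro A hA
        rw [arms_cons, Multiset.mem_cons, Multiset.mem_cons] at hA
        rcases hA with rfl | rfl | hA
        · rfl
        · rfl
        · exact h3 A hA
      · rw [arms_cons, Multiset.cons_bind, Multiset.cons_bind, Multiset.cons_bind, ← h4]
        have := pathEdges_reverse_append_cons s.reverse a r
        rw [List.reverse_reverse] at this
        rw [this]
        abel
      · rw [arms_cons, Multiset.map_cons, Multiset.map_cons, Multiset.cons_bind, ← h5]
        have : pathEnds (s ++ a :: r) =
            s.reverse.getLast?.getD a ::ₘ r.getLast?.getD a ::ₘ 0 := by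
          rw [pathEnds, List.head?_append, List.getLast?_append, List.getLast?_cons,
            List.getLast?_reverse]
          cases s.head? <;> rfl
        simp [this]
    · refine ⟨T, p ::ₘ O, h1, ?_, h3, ?_, ?_⟩
      · intro q hq
        rcases Multiset.mem_cons.1 hq with rfl | hq
        · exact ⟨hp0, hp1, hap⟩
        · exact h2 q hq
      · rw [Multiset.cons_bind, Multiset.cons_bind, ← h4]
        abel
      · rw [Multiset.cons_bind, Multiset.cons_bind, ← h5]
        abel

/-- A missing edge `ax` can be inserted into a family of edge-disjoint paths, moving one path end
from `x` to `a`, as soon as every neighbour of `a` is a path end. -/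
theorem exists_insert_edge {a x : V} {M : Multiset (List V)}
    (hM : ∀ p ∈ M, p ≠ [] ∧ p.Nodup) (hne : a ≠ x)
    (hF : (s(a, x) ::ₘ M.bind pathEdges).Nodup)
    (hends : ∀ v, s(a, v) ∈ s(a, x) ::ₘ M.bind pathEdges → v ∈ M.bind pathEnds) :
    ∃ M' : Multiset (List V), (∀ p ∈ M', p ≠ [] ∧ p.Nodup) ∧
      M'.bind pathEdges = s(a, x) ::ₘ M.bind pathEdges ∧
      M'.bind pathEnds + {x} = M.bind pathEnds + {a} := by
  obtain ⟨T, O, h1, h2, h3, h4, h5⟩ := exists_arms_of_paths a M hM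
  rw [← h5, ← h4]
  refine exists_insert_edge_of_arms a _ (h4 ▸ hF) _ T O x rfl h1 h2 rfl fun v hv => ?_
  rw [h4] at hv
  -- An empty arm has the default end `a`; this excludes it, so v is the last vertex of a nonempty
  -- arm.
  have hav : a ≠ v := by
    rintro rfl
    rcases Multiset.mem_cons.1 hv with h | h
    · exact hne (by simpa using h)
    · obtain ⟨p, hp, hp'⟩ := Multiset.mem_bind.1 h
      exact not_isDiag_of_mem_pathEdges (hM p hp).2 hp' rfl
  have := hends v hv
  rw [← h5, Multiset.mem_add, Multiset.mem_map, Multiset.mem_bind] at this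
  rcases this with ⟨A, hA, hA'⟩ | h
  · refine Or.inl ⟨A, hA, h3 A hA, ?_⟩
    cases h : A.1.getLast? with
    | none => rw [h] at hA'; exact absurd hA' hav
    | some w => rw [h] at hA'; exact congrArg some hA'
  · exact Or.inr (Or.inl h)

end PathLists

/-! ### Lovász's path decomposition theorem -/

section Lovasz

variable {V : Type*}

/-- `M` is a decomposition of the edge set `E` into paths, some of which may be trivial. -/
def IsPathFamily (E : Finset (Sym2 V)) (M : Multiset (List V)) : Prop :=
  (∀ p ∈ M, p ≠ [] ∧ p.Nodup) ∧ M.bind pathEdges = E.val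

variable [DecidableEq V]

/-- The degree of a vertex in an edge set. -/
def edgeDegree (E : Finset (Sym2 V)) (v : V) : ℕ := (E.filter (v ∈ ·)).card

/-- The number of path ends which a vertex receives. -/
def endQuota (E : Finset (Sym2 V)) (v : V) : ℕ := if Odd (edgeDegree E v) then 1 else 2

lemma one_le_endQuota (E : Finset (Sym2 V)) (v : V) : 1 ≤ endQuota E v := by
  unfold endQuota; split_ifs <;> simp

lemma endQuota_of_even {E : Finset (Sym2 V)} {v : V} (h : Even (edgeDegree E v)) :
    endQuota E v = 2 := by
  simp [endQuota, h]

lemma endQuota_of_odd {E : Finset (Sym2 V)} {v : V} (h : Odd (edgeDegree E v)) :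
    endQuota E v = 1 := by
  simp [endQuota, h]

lemma edgeDegree_erase_of_mem {E : Finset (Sym2 V)} {e : Sym2 V} (he : e ∈ E) {v : V}
    (hv : v ∈ e) : edgeDegree (E.erase e) v + 1 = edgeDegree E v := by
  rw [edgeDegree, edgeDegree, Finset.filter_erase]
  exact Finset.card_erase_add_one (Finset.mem_filter.2 ⟨he, hv⟩)

lemma edgeDegree_erase_of_notMem {E : Finset (Sym2 V)} {e : Sym2 V} {v : V}
    (hv : v ∉ e) : edgeDegree (E.erase e) v = edgeDegree E v := by
  rw [edgeDegree, edgeDegree, Finset.filter_erase, Finset.erase_eq_of_notMem]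
  simp [hv]

lemma endQuota_erase_of_notMem {E : Finset (Sym2 V)} {e : Sym2 V} {v : V}
    (hv : v ∉ e) : endQuota (E.erase e) v = endQuota E v := by
  rw [endQuota, endQuota, edgeDegree_erase_of_notMem hv]

lemma odd_edgeDegree_erase {E : Finset (Sym2 V)} {e : Sym2 V} (he : e ∈ E) {v : V}
    (hv : v ∈ e) : Odd (edgeDegree (E.erase e) v) ↔ Even (edgeDegree E v) := by
  rw [← edgeDegree_erase_of_mem he hv, Nat.even_add_one, Nat.not_even_iff_odd]

lemma IsPathFamily.insert_edge {E : Finset (Sym2 V)} (hE : ∀ e ∈ E, ¬ e.IsDiag) {a x : V}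
    (hax : s(a, x) ∈ E) {M : Multiset (List V)} (hM : IsPathFamily (E.erase s(a, x)) M)
    (hends : ∀ v, v ≠ a → (M.bind pathEnds).count v ≠ 0) :
    ∃ M', IsPathFamily E M' ∧ ∀ v, (M'.bind pathEnds).count v + (if v = x then 1 else 0) =
      (M.bind pathEnds).count v + (if v = a then 1 else 0) := by
  have hEv : s(a, x) ::ₘ M.bind pathEdges = E.val := by
    rw [hM.2, Finset.erase_val, Multiset.cons_erase hax]
  obtain ⟨M', h1, h2, h3⟩ := exists_insert_edge (a := a) (x := x) hM.1 (hE _ hax)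
    (hEv ▸ E.nodup) fun v hv => by
      rw [hEv] at hv
      exact Multiset.count_ne_zero.1 (hends v (Ne.symm (hE _ hv)))
  refine ⟨M', ⟨h1, h2.trans hEv⟩, fun v => ?_⟩
  have := congrArg (Multiset.count v) h3
  simpa [Multiset.count_singleton] using this

lemma IsPathFamily.add_trivial {E : Finset (Sym2 V)} {M : Multiset (List V)}
    (hM : IsPathFamily E M) (c : V) :
    ∃ M', IsPathFamily E M' ∧ ∀ v, (M'.bind pathEnds).count v =
      (M.bind pathEnds).count v + (if v = c then 2 else 0) := by
  refine ⟨[c] ::ₘ M, ⟨?_, by simpa using hM.2⟩, fun v => ?_⟩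
  · intro p hp
    rcases Multiset.mem_cons.1 hp with rfl | hp
    · simp
    · exact hM.1 p hp
  · rw [Multiset.cons_bind, Multiset.count_add, add_comm]
    congr 1
    have : pathEnds [c] = c ::ₘ c ::ₘ 0 := rfl
    rw [this, Multiset.count_cons, Multiset.count_cons]
    split_ifs <;> simp

lemma IsPathFamily.remove_trivial {E : Finset (Sym2 V)} {M : Multiset (List V)}
    (hM : IsPathFamily E M) {c : V} (hc : ∀ e ∈ E, c ∉ e) (hcM : c ∈ M.bind pathEnds) :
    ∃ M', IsPathFamily E M' ∧ ∀ v, (M'.bind pathEnds).count v + (if v = c then 2 else 0) =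
      (M.bind pathEnds).count v := by
  obtain ⟨p, hp, hcp⟩ := Multiset.mem_bind.1 hcM
  obtain ⟨M, rfl⟩ := Multiset.exists_cons_of_mem hp
  rcases eq_singleton_or_exists_mem_pathEdges hcp with rfl | ⟨e, he, hce⟩
  · refine ⟨M, ⟨fun q hq => hM.1 q (Multiset.mem_cons_of_mem hq), by simpa using hM.2⟩,
      fun v => ?_⟩
    rw [Multiset.cons_bind, Multiset.count_add, add_comm]
    congr 1
    have : pathEnds [c] = c ::ₘ c ::ₘ 0 := rfl
    rw [this, Multiset.count_cons, Multiset.count_cons]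
    split_ifs <;> simp
  · refine absurd hce (hc e ?_)
    rw [← Finset.mem_val, ← hM.2]
    exact Multiset.mem_bind.2 ⟨p, hp, he⟩

/-- Lovász's theorem on path decompositions: trivial paths being allowed, every vertex of odd
degree is one path end and every vertex of even degree is two path ends, except that one vertex of
even degree may be chosen to be no path end. -/
theorem exists_isPathFamily [Fintype V] (E : Finset (Sym2 V)) (hE : ∀ e ∈ E, ¬ e.IsDiag) :
    (∃ M, IsPathFamily E M ∧ ∀ v, (M.bind pathEnds).count v = endQuota E v) ∧
    ∀ c, Even (edgeDegree E c) → ∃ M, IsPathFamily E M ∧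
      ∀ v, (M.bind pathEnds).count v = if v = c then 0 else endQuota E v := by
  induction E using Finset.strongInduction with
  | H E ih =>
    have ih' : ∀ e ∈ E, _ := fun e he =>
      ih (E.erase e) (Finset.erase_ssubset he) fun f hf => hE f (Finset.mem_of_mem_erase hf)
    -- Without cx the vertex c is odd and has one end; inserting the edge at x moves that end from c
    -- to x.
    have hvertex : ∀ c x, Even (edgeDegree E c) → s(c, x) ∈ E → ∃ M, IsPathFamily E M ∧
        ∀ v, (M.bind pathEnds).count v = if v = c then 0 else endQuota E v := by
      intro c x hc hcx
      have hne : c ≠ x := hE _ hcx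
      have hc' := (odd_edgeDegree_erase hcx (Sym2.mem_mk_left c x)).2 hc
      rw [Sym2.eq_swap] at hcx hc'
      have hx' := odd_edgeDegree_erase hcx (Sym2.mem_mk_left x c)
      have key : ∀ M, IsPathFamily (E.erase s(x, c)) M →
          (∀ v, v ≠ x → (M.bind pathEnds).count v = endQuota (E.erase s(x, c)) v) →
          ((M.bind pathEnds).count x + 1 = endQuota E x) → ∃ M, IsPathFamily E M ∧
          ∀ v, (M.bind pathEnds).count v = if v = c then 0 else endQuota E v := by
        intro M hM hM1 hM2
        obtain ⟨M', h1, h2⟩ := hM.insert_edge hE hcx fun v hv => by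
          have := one_le_endQuota (E.erase s(x, c)) v
          rw [hM1 v hv]; omega
        refine ⟨M', h1, fun v => ?_⟩
        have := h2 v
        by_cases hvc : v = c
        · subst hvc
          rw [hM1 v hne, endQuota_of_odd hc'] at this
          simpa [hne] using this
        · by_cases hvx : v = x
          · subst hvx
            simpa [hvc, hM2] using this
          · rw [hM1 v hvx, endQuota_erase_of_notMem (by simp [hvc, hvx])] at this
            simpa [hvc, hvx] using this
      -- The end gained by x must complete its quota: from 1 to 2 if x is even in `E`, from 0 to 1
      -- if x is odd. The latter start uses the strengthened hypothesis.
      by_cases hx : Even (edgeDegree E x)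
      · obtain ⟨M, h1, h2⟩ := (ih' _ hcx).1
        refine key M h1 (fun v _ => h2 v) ?_
        rw [h2, endQuota_of_odd (hx'.2 hx), endQuota_of_even hx]
      · obtain ⟨M, h1, h2⟩ := (ih' _ hcx).2 x (by rwa [← Nat.not_odd_iff_even, hx'])
        refine key M h1 (fun v hv => by rw [h2, if_neg hv]) ?_
        rw [h2, if_pos rfl, endQuota_of_odd (Nat.not_even_iff_odd.1 hx)]
    have hall : ∃ M, IsPathFamily E M ∧ ∀ v, (M.bind pathEnds).count v = endQuota E v := by
      by_cases hc : ∃ c x, Even (edgeDegree E c) ∧ s(c, x) ∈ E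
      · obtain ⟨c, x, hc, hcx⟩ := hc
        obtain ⟨M, h1, h2⟩ := hvertex c x hc hcx
        obtain ⟨M', h3, h4⟩ := h1.add_trivial c
        refine ⟨M', h3, fun v => ?_⟩
        rw [h4, h2]
        split_ifs with h
        · rw [h, endQuota_of_even hc]
        · rfl
      · have hodd : ∀ a x, s(a, x) ∈ E → Odd (edgeDegree E a) := fun a x hax =>
          Nat.not_even_iff_odd.1 fun h => hc ⟨a, x, h, hax⟩
        rcases E.eq_empty_or_nonempty with rfl | ⟨e, he⟩
        · refine ⟨Finset.univ.val.map fun v => [v], ⟨by simp, ?_⟩, fun v => ?_⟩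
          · simp [Multiset.bind_map]
          · have h0 : Even (edgeDegree (∅ : Finset (Sym2 V)) v) := by simp [edgeDegree]
            rw [endQuota_of_even h0]
            have : ∀ v : V, pathEnds [v] = {v} + {v} := fun v => rfl
            have h1 : (Finset.univ : Finset V).val.bind (fun w => {w}) = Finset.univ.val := by
              simpa using Multiset.bind_singleton (Finset.univ : Finset V).val id
            simp only [Multiset.bind_map, this, Multiset.bind_add, h1, Multiset.count_add,
              Multiset.count_univ]
        · induction e using Sym2.ind with
          | _ a x =>
            have hne : a ≠ x := hE _ he
            have hoa := hodd a x he
            have hox := hodd x a (Sym2.eq_swap ▸ he)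
            have ha' := odd_edgeDegree_erase he (Sym2.mem_mk_left a x)
            have hx' := odd_edgeDegree_erase he (Sym2.mem_mk_right a x)
            rw [← not_iff_not, Nat.not_odd_iff_even, Nat.not_even_iff_odd] at ha' hx'
            -- Both a and x are even without ax. Starting with 0 ends at a and 2 at x, the insertion
            -- leaves one at each.
            obtain ⟨M, h1, h2⟩ := (ih' _ he).2 a (ha'.2 hoa)
            obtain ⟨M', h3, h4⟩ := h1.insert_edge hE he fun v hv => by
              have := one_le_endQuota (E.erase s(a, x)) v
              rw [h2, if_neg hv]; omega
            refine ⟨M', h3, fun v => ?_⟩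
            have := h4 v
            rw [h2] at this
            by_cases hva : v = a
            · subst hva
              rw [endQuota_of_odd hoa]
              simpa [hne] using this
            · by_cases hvx : v = x
              · subst hvx
                rw [endQuota_of_even (hx'.2 hox)] at this
                rw [endQuota_of_odd hox]
                simpa [hva] using this
              · rw [endQuota_erase_of_notMem (by simp [hva, hvx])] at this
                simpa [hva, hvx] using this
    refine ⟨hall, fun c hc => ?_⟩
    by_cases hce : ∃ x, s(c, x) ∈ E
    · obtain ⟨x, hx⟩ := hce
      exact hvertex c x hc hx
    · obtain ⟨M, h1, h2⟩ := hall
      have hcE : ∀ e ∈ E, c ∉ e := by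
        rintro e he ⟨x, rfl⟩
        exact hce ⟨x, he⟩
      obtain ⟨M', h3, h4⟩ := h1.remove_trivial hcE (by
        rw [← Multiset.count_ne_zero, h2]
        have := one_le_endQuota E c
        omega)
      refine ⟨M', h3, fun v => ?_⟩
      have := h4 v
      rw [h2] at this
      split_ifs with h
      · subst h
        simpa [endQuota_of_even hc] using this
      · simpa [h] using this

end Lovasz

/-! ### Rooted paths and paths in the product -/

section Product

variable {V W : Type*}

lemma card_pathEnds {p : List V} (hp : p ≠ []) : (pathEnds p).card = 2 := by
  cases p with
  | nil => exact absurd rfl hp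
  | cons a l => simp [pathEnds, List.getLast?_cons]

lemma card_bind_pathEnds {M : Multiset (List V)} (hM : ∀ p ∈ M, p ≠ []) :
    (M.bind pathEnds).card = 2 * M.card := by
  have h : M.map (Multiset.card ∘ pathEnds) = M.map fun _ => 2 :=
    Multiset.map_congr rfl fun p hp => card_pathEnds (hM p hp)
  rw [Multiset.card_bind, h]
  simp [mul_comm]

/-- Every edge set decomposes into paths, one starting at each vertex. -/
theorem exists_rooted_paths [Fintype W] [DecidableEq W] (E : Finset (Sym2 W))
    (hE : ∀ e ∈ E, ¬ e.IsDiag) :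
    ∃ f : W → List W, (∀ v, (f v).head? = some v ∧ (f v).Nodup) ∧
      (Finset.univ : Finset W).val.bind (fun v => pathEdges (f v)) = E.val := by
  obtain ⟨M, ⟨hM, hME⟩, hends⟩ := (exists_isPathFamily E hE).1
  obtain ⟨L, rfl⟩ := Quot.exists_rep M
  change ∀ p ∈ (L : Multiset (List W)), _ at hM
  change (L : Multiset (List W)).bind _ = _ at hME
  change ∀ v, ((L : Multiset (List W)).bind _).count v = _ at hends
  -- Double counting of ends with multiplicity: 2|s| ≤ 2|U|. A trivial path counts its vertex twice.
  have hHall : ∀ s : Finset (Fin L.length),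
      s.card ≤ (s.biUnion fun i => (pathEnds L[i]).toFinset).card := by
    intro s
    set U := s.biUnion fun i => (pathEnds L[i]).toFinset with hU
    have h1 : ∀ i ∈ s, ∑ v ∈ U, (pathEnds L[i]).count v = 2 := by
      intro i hi
      rw [Multiset.sum_count_eq_card, card_pathEnds]
      · exact (hM _ (by simp)).1
      · intro v hv
        exact Finset.mem_biUnion.2 ⟨i, hi, Multiset.mem_toFinset.2 hv⟩
    have h2 : ∀ v ∈ U, ∑ i ∈ s, (pathEnds L[i]).count v ≤ 2 := by
      intro v _
      calc ∑ i ∈ s, (pathEnds L[i]).count v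
          ≤ ∑ i : Fin L.length, (pathEnds L[i]).count v :=
            Finset.sum_le_sum_of_subset (Finset.subset_univ s)
        _ = ((L : Multiset (List W)).bind pathEnds).count v := by
            rw [Multiset.count_bind, Multiset.map_coe, Multiset.sum_coe]
            exact Fin.sum_univ_fun_getElem L fun p => (pathEnds p).count v
        _ ≤ 2 := by
            rw [hends]
            unfold endQuota
            split_ifs <;> simp
    have h3 := Finset.sum_le_sum h2
    rw [Finset.sum_comm, Finset.sum_congr rfl h1] at h3
    simpa using h3
  obtain ⟨g, hg, hgL⟩ := (Finset.all_card_le_biUnion_card_iff_exists_injective _).1 hHall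
  have horient : ∀ i, ∃ q : List W, q.head? = some (g i) ∧ q.Nodup ∧
      pathEdges q = pathEdges L[i] := by
    intro i
    have h := hgL i
    have hn := (hM L[i] (by simp)).2
    simp only [pathEnds, Multiset.mem_toFinset, Multiset.mem_coe, List.mem_append,
      Option.mem_toList] at h
    rcases h with h | h
    · exact ⟨L[i], h, hn, rfl⟩
    · exact ⟨L[i].reverse, by rw [List.head?_reverse]; exact h, List.nodup_reverse.2 hn,
        pathEdges_reverse _⟩
  choose q hq1 hq2 hq3 using horient
  classical
  let f : W → List W := fun v => if h : ∃ i, g i = v then q h.choose else [v]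
  have hfg : ∀ i, f (g i) = q i := by
    intro i
    have h : ∃ j, g j = g i := ⟨i, rfl⟩
    simp only [f, dif_pos h]
    rw [hg h.choose_spec]
  refine ⟨f, fun v => ?_, ?_⟩
  · by_cases h : ∃ i, g i = v
    · obtain ⟨i, rfl⟩ := h
      rw [hfg]
      exact ⟨hq1 i, hq2 i⟩
    · simp [f, dif_neg h]
  · have h1 : ∑ i : Fin L.length, pathEdges L[i] = ∑ v, pathEdges (f v) := by
      refine Fintype.sum_of_injective g hg _ _ (fun v hv => ?_) fun i => by rw [hfg, hq3]
      have : ¬ ∃ i, g i = v := hv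
      simp [f, dif_neg this]
    have h2 := Fin.sum_univ_fun_getElem L pathEdges
    change ∑ v, pathEdges (f v) = _
    rw [← h1, ← hME]
    refine h2.trans ?_
    rw [Multiset.bind, Multiset.join, Multiset.map_coe, Multiset.sum_coe]

/-- A path `p` of the first factor and rooted paths of the second factor combine to paths in the
product: the copies of the rooted path at `v` over both ends of `p` are joined by the copy of `p`
at `v`. -/
lemma exists_product_path {p : List V} (hp : p.Nodup) (hp2 : 2 ≤ p.length) {v : W} {r : List W}
    (hr : r.head? = some v) (hrn : r.Nodup) :
    ∃ q : List (V × W), (q ≠ [] ∧ q.Nodup) ∧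
      pathEdges q = (pathEdges p).map (Sym2.map fun u => (u, v)) +
        (pathEnds p).bind fun u => (pathEdges r).map (Sym2.map fun w => (u, w)) := by
  obtain ⟨a, mid, b, rfl⟩ : ∃ a mid b, p = a :: (mid ++ [b]) := by
    obtain ⟨a, p, rfl⟩ := List.exists_cons_of_length_pos (by omega : 0 < p.length)
    have hp0 : p ≠ [] := by rintro rfl; simp at hp2
    exact ⟨a, p.dropLast, p.getLast hp0, by rw [List.dropLast_append_getLast]⟩
  obtain ⟨t, rfl⟩ : ∃ t, r = v :: t := by
    cases r with
    | nil => simp at hr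
    | cons c t => simp at hr; exact ⟨t, by rw [hr]⟩
  -- The ends a and b differ because `p` has at least two vertices, and `r` meets v only at its
  -- start; hence no vertex repeats.
  refine ⟨(t.reverse.map fun w => (a, w)) ++ (a, v) :: ((mid.map fun u => (u, v)) ++
    (b, v) :: t.map fun w => (b, w)), ⟨by simp, ?_⟩, ?_⟩
  · have inj1 : ∀ u : V, Function.Injective fun w : W => (u, w) := fun u x y h => by simpa using h
    have inj2 : Function.Injective fun u : V => (u, v) := fun x y h => by simpa using h
    simp only [List.nodup_cons, List.nodup_append', List.mem_append, not_or,
      List.disjoint_singleton, List.mem_singleton] at hp hrn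
    obtain ⟨⟨ha, hab⟩, hmid, -, hb⟩ := hp
    obtain ⟨hv, ht⟩ := hrn
    rw [List.nodup_append', List.nodup_cons, List.nodup_append', List.nodup_cons]
    refine ⟨(List.nodup_reverse.2 ht).map (inj1 a), ⟨?_, hmid.map inj2, ⟨?_, ht.map (inj1 b)⟩, ?_⟩,
      ?_⟩
    · simp [ha, hab, Ne.symm hab]
    · simp [hv]
    · rintro ⟨x, y⟩ h1 h2
      simp at h1 h2
      rcases h2 with h2 | h2
      · exact hb (h2.1 ▸ h1.1)
      · exact hb (h2.2 ▸ h1.1)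
    · rintro ⟨x, y⟩ h1 h2
      simp at h1 h2
      rcases h2 with h2 | h2 | h2 | h2
      · exact hv (h2.2 ▸ h1.1)
      · exact ha (h1.2 ▸ h2.1)
      · exact hab (h1.2.trans h2.1)
      · exact hab (h1.2.trans h2.2.symm)
  · have e1 : (a, v) :: ((mid.map fun u => (u, v)) ++ (b, v) :: t.map fun w => (b, w)) =
        ((a :: mid).map fun u => (u, v)) ++ (b, v) :: t.map fun w => (b, w) := rfl
    have e2 : (t.reverse.map fun w => (a, w)) ++ [(a, v)] =
        (v :: t).reverse.map fun w => (a, w) := by simp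
    have e3 : ((a :: mid).map fun u => (u, v)) ++ [(b, v)] =
        (a :: (mid ++ [b])).map fun u => (u, v) := by simp
    have e4 : ((b, v) :: t.map fun w => (b, w)) = (v :: t).map fun w => (b, w) := rfl
    have e5 : pathEnds (a :: (mid ++ [b])) = {a} + {b} := by
      simp [pathEnds, List.getLast?_cons, List.getLast?_append]
      rfl
    rw [pathEdges_append_cons, e1, pathEdges_append_cons (List.map _ _) (b, v), e2, e3, e4, pathEdges_map,
      pathEdges_map, pathEdges_map, pathEdges_reverse, e5, Multiset.add_bind,
      Multiset.singleton_bind, Multiset.singleton_bind]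
    abel

lemma exists_walk_of_list (G : SimpleGraph V) (l : List V) :
    ∀ a, (∀ e ∈ pathEdges (a :: l), e ∈ G.edgeSet) →
      ∃ (b : V) (w : G.Walk a b), w.support = a :: l ∧
        ∀ e, e ∈ w.edges ↔ e ∈ pathEdges (a :: l) := by
  induction l with
  | nil => exact fun a _ => ⟨a, .nil, rfl, by simp⟩
  | cons c l ih =>
    intro a h
    obtain ⟨b, w, h1, h2⟩ := ih c fun e he => h e (Multiset.mem_cons_of_mem he)
    have hac : G.Adj a c := h s(a, c) (Multiset.mem_cons_self _ _)
    exact ⟨b, .cons hac w, by simp [h1], fun e => by simp [h2]⟩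

lemma exists_isPathSubgraph (G : SimpleGraph V) {p : List V} (hp : p ≠ [] ∧ p.Nodup)
    (hG : ∀ e ∈ pathEdges p, e ∈ G.edgeSet) :
    ∃ P : G.Subgraph, P.IsPathSubgraph ∧ ∀ e, e ∈ P.edgeSet ↔ e ∈ pathEdges p := by
  obtain ⟨a, l, rfl⟩ := List.exists_cons_of_ne_nil hp.1
  obtain ⟨b, w, h1, h2⟩ := exists_walk_of_list G l a hG
  refine ⟨w.toSubgraph, ⟨a, b, w, ?_, rfl⟩, fun e => by rw [← h2]; simp⟩
  rw [SimpleGraph.Walk.isPath_def, h1]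
  exact hp.2

/-- The path number is at most the size of a family of lists tracing edge-disjoint paths. -/
theorem pathNumber_le_card (G : SimpleGraph V) {M : Multiset (List V)}
    (hM : ∀ p ∈ M, p ≠ [] ∧ p.Nodup) (hn : (M.bind pathEdges).Nodup)
    (hG : ∀ e, e ∈ M.bind pathEdges ↔ e ∈ G.edgeSet) : G.pathNumber ≤ M.card := by
  classical
  have h : ∀ p, p ∈ M → ∃ P : G.Subgraph, P.IsPathSubgraph ∧
      ∀ e, e ∈ P.edgeSet ↔ e ∈ pathEdges p := fun p hp =>
    exists_isPathSubgraph G (hM p hp) fun e he => (hG e).1 (Multiset.mem_bind.2 ⟨p, hp, he⟩)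
  choose! g hg1 hg2 using h
  refine le_trans (Nat.sInf_le ⟨(M.map g).toFinset, ⟨?_, ?_, ?_⟩, rfl⟩)
    ((Multiset.toFinset_card_le _).trans (Multiset.card_map g M).le)
  · intro P hP
    obtain ⟨p, hp, rfl⟩ := Multiset.mem_map.1 (Multiset.mem_toFinset.1 hP)
    exact hg1 p hp
  · intro P hP Q hQ hne
    obtain ⟨p, hp, rfl⟩ := Multiset.mem_map.1 (Multiset.mem_toFinset.1 hP)
    obtain ⟨q, hq, rfl⟩ := Multiset.mem_map.1 (Multiset.mem_toFinset.1 hQ)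
    rw [Set.disjoint_left]
    intro e he he'
    rw [hg2 p hp] at he
    rw [hg2 q hq] at he'
    obtain ⟨M, rfl⟩ := Multiset.exists_cons_of_mem hp
    have hqM : q ∈ M := (Multiset.mem_cons.1 hq).resolve_left fun h => hne (h ▸ rfl)
    rw [Multiset.cons_bind, Multiset.nodup_add] at hn
    exact Multiset.disjoint_left.1 hn.2.2 he (Multiset.mem_bind.2 ⟨q, hqM, he'⟩)
  · intro e he
    obtain ⟨p, hp, hep⟩ := Multiset.mem_bind.1 ((hG e).2 he)
    exact ⟨g p, Multiset.mem_toFinset.2 (Multiset.mem_map_of_mem g hp), (hg2 p hp e).2 hep⟩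

/-- Disjointness of the copies of one factor's edges: an endpoint determines both the copy and the
original vertex. -/
lemma nodup_bind_map_sym2 {X Y Z : Type*} [Fintype X] {E : Finset (Sym2 Y)} {φ : X → Y → Z}
    (hφ : ∀ x x' y y', φ x y = φ x' y' → x = x' ∧ y = y') :
    ((Finset.univ : Finset X).val.bind fun x => E.val.map (Sym2.map (φ x))).Nodup := by
  have : ((Finset.univ : Finset X).val.bind fun x => E.val.map (Sym2.map (φ x))) =
      ((Finset.univ : Finset X) ×ˢ E).val.map fun z => Sym2.map (φ z.1) z.2 := by
    rw [Finset.product_val]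
    change _ = Multiset.map _ (Multiset.bind _ _)
    simp [Multiset.map_bind]
  rw [this]
  refine (Finset.nodup _).map ?_
  rintro ⟨x, e⟩ ⟨x', e'⟩ h
  induction e using Sym2.ind with
  | _ a b =>
    induction e' using Sym2.ind with
    | _ c d =>
      simp only [Sym2.map_mk, Sym2.eq_iff] at h
      rcases h with ⟨h1, h2⟩ | ⟨h1, h2⟩
      · obtain ⟨rfl, rfl⟩ := hφ _ _ _ _ h1
        obtain ⟨-, rfl⟩ := hφ _ _ _ _ h2
        rfl
      · obtain ⟨rfl, rfl⟩ := hφ _ _ _ _ h1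
        obtain ⟨-, rfl⟩ := hφ _ _ _ _ h2
        rw [Sym2.eq_swap]

/-- The edges of a Cartesian product are the copies of the edges of the factors. -/
lemma mem_edgeSet_boxProd_iff [Fintype V] [Fintype W] (G : SimpleGraph V) (H : SimpleGraph W)
    [Fintype G.edgeSet] [Fintype H.edgeSet] (e : Sym2 (V × W)) :
    e ∈ ((Finset.univ : Finset W).val.bind fun v =>
        G.edgeFinset.val.map (Sym2.map fun u => (u, v))) +
      ((Finset.univ : Finset V).val.bind fun u =>
        H.edgeFinset.val.map (Sym2.map fun w => (u, w))) ↔ e ∈ (G.boxProd H).edgeSet := by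
  simp only [Multiset.mem_add, Multiset.mem_bind, Multiset.mem_map, Finset.mem_val,
    Finset.mem_univ, true_and, SimpleGraph.mem_edgeFinset]
  constructor
  · rintro (⟨v, e, he, rfl⟩ | ⟨v, e, he, rfl⟩) <;> induction e using Sym2.ind <;>
      simpa [SimpleGraph.boxProd_adj] using he
  · induction e using Sym2.ind with
    | _ x y =>
      obtain ⟨x1, x2⟩ := x
      obtain ⟨y1, y2⟩ := y
      rw [SimpleGraph.mem_edgeSet, SimpleGraph.boxProd_adj]
      rintro (⟨h, h'⟩ | ⟨h, h'⟩)
      · simp only at h h'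
        subst h'
        exact Or.inl ⟨x2, s(x1, y1), h, rfl⟩
      · simp only at h h'
        subst h'
        exact Or.inr ⟨x1, s(x2, y2), h, rfl⟩

end Product

theorem corollary4p3 {V W : Type*} [Fintype V] [Fintype W]
    (G : SimpleGraph V) [DecidableRel G.Adj] (H : SimpleGraph W) (m n : ℕ)
    (hm : Fintype.card V = m) (hm2 : 2 ≤ m) (hn : Fintype.card W = n)
    (hG : G.Connected) (hodd : ∀ v : V, Odd (G.degree v)) (hH : H.Connected) :
    ((G.boxProd H).pathNumber : ℚ) ≤ (m : ℚ) * (n : ℚ) / 2 := by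
  classical
  obtain ⟨f, hf, hfE⟩ := exists_rooted_paths H.edgeFinset fun e he =>
    H.not_isDiag_of_mem_edgeFinset he
  obtain ⟨M, ⟨hM, hME⟩, hends⟩ := (exists_isPathFamily G.edgeFinset fun e he =>
    G.not_isDiag_of_mem_edgeFinset he).1
  have hcount : M.bind pathEnds = (Finset.univ : Finset V).val := by
    ext v
    rw [hends, Multiset.count_univ, endQuota_of_odd]
    rw [edgeDegree, ← SimpleGraph.incidenceFinset_eq_filter,
      SimpleGraph.card_incidenceFinset_eq_degree]
    exact hodd v
  have hcard : 2 * M.card = m := by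
    rw [← card_bind_pathEnds fun p hp => (hM p hp).1, hcount, ← hm]
    rfl
  have hlength : ∀ p ∈ M, 2 ≤ p.length := by
    intro p hp
    obtain ⟨M, rfl⟩ := Multiset.exists_cons_of_mem hp
    rcases p with _ | ⟨a, _ | ⟨b, p⟩⟩
    · exact absurd rfl (hM _ hp).1
    -- A trivial path would make a an end twice.
    · have h1 := congrArg (Multiset.count a) hcount
      have h2 : pathEnds [a] = {a} + {a} := rfl
      rw [Multiset.cons_bind, h2, Multiset.count_add, Multiset.count_add,
        Multiset.count_singleton_self, Multiset.count_univ] at h1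
      omega
    · simp
  have hq : ∀ p, p ∈ M → ∀ v, _ := fun p hp v =>
    exists_product_path (hM p hp).2 (hlength p hp) (hf v).1 (hf v).2
  choose! q hq1 hq2 using hq
  have hedges : (M.bind fun p => (Finset.univ : Finset W).val.map (q p)).bind pathEdges =
      ((Finset.univ : Finset W).val.bind fun v =>
        G.edgeFinset.val.map (Sym2.map fun u => (u, v))) +
      ((Finset.univ : Finset V).val.bind fun u =>
        H.edgeFinset.val.map (Sym2.map fun w => (u, w))) := by
    rw [Multiset.bind_assoc, Multiset.bind_congr fun p hp =>
      (Multiset.bind_map _ _ _).trans (Multiset.bind_congr fun v _ => hq2 p hp v),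
      Multiset.bind_bind]
    simp only [Multiset.bind_add]
    congr 1
    · refine Multiset.bind_congr fun v _ => ?_
      rw [← hME, Multiset.map_bind]
    · simp only [← Multiset.bind_assoc]
      -- The ends run through V once, so each fibre over u receives every rooted path once.
      rw [hcount, Multiset.bind_bind]
      refine Multiset.bind_congr fun u _ => ?_
      rw [← hfE, Multiset.map_bind]
  have hle : (G.boxProd H).pathNumber ≤ M.card * n := by
    have h := pathNumber_le_card (G.boxProd H)
      (M := M.bind fun p => (Finset.univ : Finset W).val.map (q p)) ?_ ?_ ?_
    · simpa [Multiset.card_bind, Function.comp_def, ← hn] using h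
    · intro r hr
      obtain ⟨p, hp, hr⟩ := Multiset.mem_bind.1 hr
      obtain ⟨v, -, rfl⟩ := Multiset.mem_map.1 hr
      exact hq1 p hp v
    · rw [hedges, Multiset.nodup_add]
      refine ⟨nodup_bind_map_sym2 fun v v' u u' h => ?_, nodup_bind_map_sym2 fun u u' w w' h => ?_,
        Multiset.disjoint_left.2 fun {e} he he' => ?_⟩
      · simp only [Prod.mk.injEq] at h
        exact ⟨h.2, h.1⟩
      · simpa using h
      -- A common edge would have constant first coordinate, making an edge of G a loop.
      · obtain ⟨v, -, he⟩ := Multiset.mem_bind.1 he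
        obtain ⟨d, hd, rfl⟩ := Multiset.mem_map.1 he
        obtain ⟨u, -, he'⟩ := Multiset.mem_bind.1 he'
        obtain ⟨d', hd', h⟩ := Multiset.mem_map.1 he'
        induction d using Sym2.ind with
        | _ a b =>
          induction d' using Sym2.ind with
          | _ c d =>
            have hab := G.not_isDiag_of_mem_edgeFinset hd
            simp only [Sym2.map_mk, Sym2.eq_iff, Prod.mk.injEq] at h
            rcases h with ⟨h1, h2⟩ | ⟨h1, h2⟩
            · exact hab (h1.1.symm.trans h2.1)
            · exact hab (h2.1.symm.trans h1.1)
    · intro e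
      rw [hedges]
      exact mem_edgeSet_boxProd_iff G H e
  have hle' : ((G.boxProd H).pathNumber : ℚ) ≤ M.card * n := by exact_mod_cast hle
  have hcard' : (2 : ℚ) * M.card = m := by exact_mod_cast hcard
  rw [← hcard']
  linarith
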